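/- Let $0<p<1$ and let $f_p(z)=\sum_{j\ge 0}\frac{p^{\binom j2}}{j!}z^j$ $(z\in\mathbb C)$ be the deformed exponential function, which is entire. Then all complex zeros of $f_p$ are real and negative, there are infinitely many of them, and, listed with multiplicity, they form a sequence $0>a_1\ge a_2\ge a_3\ge\cdots$. Put $c_i=-1/a_i>0$, so that $c_1\ge c_2\ge\cdots$. There is a partition of $[0,1]$ into intervals $V_1,V_2,\dots$ with $|V_i|=c_i$ for every $i$, such that the complete infinite-partite graph $W_p$ with vertex set $[0,1]$ and parts $V_1,V_2,\dots$ (two points are adjacent if and only if they lie in different parts) has a measurable edge set $\{(x,y)\in[0,1]^2 : x\sim y\}$ and satisfies: 1. For every $k\ge 2$, if $v_1,\dots,v_k$ are chosen independently and uniformly (with respect to Lebesgue measure) from $[0,1]$, then the probability that $v_i$ and $v_j$ are adjacent in $W_p$ for all $i<j$ is exactly $p^{\binom k2}$. 2. $c_1\ge 1-p$; thus the independent interval $V_1$ has length at least $1-p$. Moreover, there is an interval $I\subseteq[0,1]$ of length exactly $1-p$ such that no two points of $I$ are adjacent in $W_p$. -/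

import Mathlib

open MeasureTheory

/-- The deformed exponential function
`f_p(z) = ∑_{j ≥ 0} p ^ (j choose 2) / j! * z ^ j`, as a function of a complex variable. -/
noncomputable def deformedExp (p : ℝ) (z : ℂ) : ℂ :=
  ∑' j : ℕ, (p : ℂ) ^ (j.choose 2) / (j.factorial : ℂ) * z ^ j

theorem norm_deformedExp_term_le {p : ℝ} (hp : |p| ≤ 1) (z : ℂ) (j : ℕ) :
    ‖(p : ℂ) ^ (j.choose 2) / (j.factorial : ℂ) * z ^ j‖ ≤ ‖z‖ ^ j / (j.factorial : ℝ) := by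
  rw [norm_mul, norm_div, norm_pow, norm_pow, Complex.norm_real, Complex.norm_natCast,
    Real.norm_eq_abs, div_mul_eq_mul_div]
  gcongr
  exact mul_le_of_le_one_left (by positivity) (pow_le_one₀ (abs_nonneg p) hp)

/-- The series defining `deformedExp p z` converges absolutely, so its sum is not a junk value. -/
theorem summable_deformedExp {p : ℝ} (hp : |p| ≤ 1) (z : ℂ) :
    Summable fun j : ℕ => (p : ℂ) ^ (j.choose 2) / (j.factorial : ℂ) * z ^ j :=
  Summable.of_norm_bounded (Real.summable_pow_div_factorial ‖z‖) (norm_deformedExp_term_le hp z)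

/-- `deformedExp p` is an entire function, so its order of vanishing at each point is meaningful. -/
theorem differentiable_deformedExp {p : ℝ} (hp : |p| ≤ 1) : Differentiable ℂ (deformedExp p) := by
  intro z
  have h : DifferentiableOn ℂ (deformedExp p) (Metric.ball 0 (‖z‖ + 1)) := by
    refine Complex.differentiableOn_tsum_of_summable_norm
      (Real.summable_pow_div_factorial (‖z‖ + 1)) (fun j => ?_) Metric.isOpen_ball
      (fun j w hw => ?_)
    · fun_prop
    · refine (norm_deformedExp_term_le hp w j).trans ?_
      have : ‖w‖ ≤ ‖z‖ + 1 := (mem_ball_zero_iff.mp hw).le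
      gcongr
  exact h.differentiableAt (Metric.isOpen_ball.mem_nhds (by simp))

/-- The sequence `a` lists all the complex zeros of the entire function `f`, each zero being
listed as many times as its multiplicity (and non-zeros of `f` not being listed). -/
def ListsZeros (f : ℂ → ℂ) (a : ℕ → ℂ) : Prop :=
  ∀ z : ℂ, {i : ℕ | a i = z}.encard = analyticOrderAt f z

/-- `W` is the complete infinite-partite graph with parts `V 0, V 1, V 2, …`: the parts partition
the vertex set, and two vertices are adjacent exactly when they lie in different parts. -/
structure IsCompleteInfinitePartite {X : Type*} (W : SimpleGraph X) (V : ℕ → Set X) : Prop where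
  disjoint : Pairwise fun i j => Disjoint (V i) (V j)
  cover : ⋃ i, V i = Set.univ
  nonempty : ∀ i, (V i).Nonempty
  adj_iff : ∀ x y, W.Adj x y ↔ ∃ i j, i ≠ j ∧ x ∈ V i ∧ y ∈ V j

/-!
The deformed exponential is the limit of the polynomials
`∑ j, (n choose j) p ^ (j choose 2) (z / n) ^ j`. By Pascal's rule the unscaled polynomials satisfy
`Q_{n+1}(z) = Q_n(z) + z Q_n(p z)`. Writing `Q_n(z) = ∏ (1 + c i z)`, this recursion preserves the
property that the `c i` are positive and each is less than `p` times its predecessor: evaluated at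
`-1 / y`, the polynomial `Q_{n+1}` changes sign on each interval `(c i, p c (i - 1))`
and beyond `c 0` (`exists_roots_interlacing`).

After rescaling by `n` the `c i` sum to `1`, so the `i`-th of them is at most `p ^ i` whatever `n` is.
This bound gives a subsequence along which every `c i` converges, and it dominates all the sums and
products involved, so no mass is lost: the limit sequence has elementary symmetric functions
`p ^ (k choose 2) / k!`, which are the Taylor coefficients of `f_p`, and
`f_p(z) = ∏ (1 + c i z)` follows without Hadamard's theorem (`exists_deformedExp_eq_tprod`). The
geometric decay survives in the limit; it makes the zeros `-1 / c i` simple and, since the `c i` sum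
to `1`, gives `c 0 ≥ 1 - p`.

Finally `[0, 1]` is cut into intervals of lengths `c i` (`exists_interval_partition`). Points
`v_1, …, v_k` form a clique when they lie in distinct parts, so the clique probability is the sum of
`∏ c (σ i)` over the injections `σ`, that is `k!` times the `k`-th elementary symmetric function,
which is `p ^ (k choose 2)` (`volume_clique_eq_tsum`, `tsum_embedding_prod_eq`).
-/

open Finset Polynomial Filter Topology

/-! ### Polynomials with interlacing roots -/

theorem nonneg_of_succ_lt_mul {p : ℝ} (hp0 : 0 < p) {n : ℕ} {c : ℕ → ℝ}
    (h0 : ∀ i, n ≤ i → c i = 0) (hs : ∀ i < n, c (i + 1) < p * c i) (i : ℕ) : 0 ≤ c i := by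
  rcases le_total n i with h | h
  · exact (h0 i h).ge
  · refine Nat.decreasingInduction (motive := fun i _ => 0 ≤ c i) (fun k hk ih => ?_)
      (h0 n le_rfl).ge h
    exact (pos_of_mul_pos_right (ih.trans_lt (hs k hk)) hp0.le).le

theorem succ_le_mul_of_succ_lt_mul {p : ℝ} {n : ℕ} {c : ℕ → ℝ}
    (h0 : ∀ i, n ≤ i → c i = 0) (hs : ∀ i < n, c (i + 1) < p * c i) (i : ℕ) :
    c (i + 1) ≤ p * c i := by
  rcases lt_or_ge i n with h | h
  · exact (hs i h).le
  · rw [h0 i h, h0 (i + 1) (by omega), mul_zero]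

/-- A product of `n` real factors of which exactly the first `m` are negative has the sign of
`(-1) ^ m`. -/
theorem neg_one_pow_mul_prod_sub_pos {m n : ℕ} (hmn : m ≤ n) {b : ℕ → ℝ} {y : ℝ}
    (h1 : ∀ j < m, y < b j) (h2 : ∀ j, m ≤ j → j < n → b j < y) :
    0 < (-1) ^ m * ∏ j ∈ range n, (y - b j) := by
  have h : (-1) ^ m * ∏ j ∈ range m, (y - b j) = ∏ j ∈ range m, (b j - y) := by
    conv_lhs => rw [← Finset.card_range m, ← Finset.prod_const]
    rw [Finset.card_range, ← Finset.prod_mul_distrib]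
    exact Finset.prod_congr rfl fun j _ => by ring
  rw [← Finset.prod_range_mul_prod_Ico _ hmn, ← mul_assoc, h]
  refine mul_pos (Finset.prod_pos fun j hj => ?_) (Finset.prod_pos fun j hj => ?_)
  · exact sub_pos.2 (h1 j (Finset.mem_range.1 hj))
  · exact sub_pos.2 (h2 j (Finset.mem_Ico.1 hj).1 (Finset.mem_Ico.1 hj).2)

/-- The interlacing step: if `c 0, …, c (n - 1)` are positive and each is less than `p` times its
predecessor, then `y ∏ (y - c i) - ∏ (y - p c i)` has `n + 1` positive roots with the same
property. It changes sign on each gap `(c i, p c (i - 1))`, including the last one,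
where `c n = 0`, and on `(c 0, ∞)`, so there is a root in each. -/
theorem exists_roots_interlacing {p : ℝ} (hp0 : 0 < p) (hp1 : p < 1) (n : ℕ) (c : ℕ → ℝ)
    (h0 : ∀ i, n ≤ i → c i = 0) (hs : ∀ i < n, c (i + 1) < p * c i) :
    ∃ c' : ℕ → ℝ, (∀ i, n + 1 ≤ i → c' i = 0) ∧ (∀ i < n + 1, c' (i + 1) < p * c' i) ∧
      ∀ y : ℝ, y * ∏ i ∈ range n, (y - c i) - ∏ i ∈ range n, (y - p * c i) =
        ∏ i ∈ range (n + 1), (y - c' i) := by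
  have hnn := nonneg_of_succ_lt_mul hp0 h0 hs
  have hle := succ_le_mul_of_succ_lt_mul h0 hs
  have hanti : Antitone c := antitone_nat_of_succ_le fun i =>
    (hle i).trans (mul_le_of_le_one_left (hnn i) hp1.le)
  have hpos : ∀ i < n, 0 < c i := fun i hi =>
    pos_of_mul_pos_right ((hnn (i + 1)).trans_lt (hs i hi)) hp0.le
  have hpc : ∀ i < n, p * c i < c i := fun i hi => mul_lt_of_lt_one_left (hpos i hi) hp1
  set H : ℝ[X] := X * ∏ i ∈ range n, (X - C (c i)) - ∏ i ∈ range n, (X - C (p * c i)) with hH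
  have hm1 : (X * ∏ i ∈ range n, (X - C (c i)) : ℝ[X]).Monic :=
    monic_X.mul (monic_prod_X_sub_C _ _)
  have hm2 : (∏ i ∈ range n, (X - C (p * c i)) : ℝ[X]).Monic := monic_prod_X_sub_C _ _
  have hd2 : (∏ i ∈ range n, (X - C (p * c i)) : ℝ[X]).natDegree = n := by
    rw [natDegree_finsetProd_X_sub_C_eq_card, card_range]
  have hd1 : (X * ∏ i ∈ range n, (X - C (c i)) : ℝ[X]).natDegree = n + 1 := by
    rw [monic_X.natDegree_mul (monic_prod_X_sub_C _ _), natDegree_X,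
      natDegree_finsetProd_X_sub_C_eq_card, card_range, add_comm]
  have hlt : (∏ i ∈ range n, (X - C (p * c i)) : ℝ[X]).degree
      < (X * ∏ i ∈ range n, (X - C (c i)) : ℝ[X]).degree := by
    rw [degree_eq_natDegree hm1.ne_zero, degree_eq_natDegree hm2.ne_zero, hd1, hd2]
    exact_mod_cast n.lt_succ_self
  have hHm : H.Monic := hm1.sub_of_left hlt
  have hHd : H.degree = ((n + 1 : ℕ) : WithBot ℕ) := by
    rw [hH, degree_sub_eq_left_of_degree_lt hlt, degree_eq_natDegree hm1.ne_zero, hd1]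
  have hev : ∀ y, H.eval y =
      y * ∏ i ∈ range n, (y - c i) - ∏ i ∈ range n, (y - p * c i) := fun y => by
    simp [hH, eval_prod]
  -- at `c i` the first product vanishes (for `i = n` its factor `y = c n = 0` does), at `p * c (i - 1)`
  -- the second one, so each value is a single product whose sign is known
  have hleft : ∀ i ≤ n, (-1) ^ i * H.eval (c i) < 0 := by
    intro i hi
    have hz : c i * ∏ j ∈ range n, (c i - c j) = 0 := by
      rcases hi.lt_or_eq with h | h
      · rw [Finset.prod_eq_zero (Finset.mem_range.2 h) (sub_self _), mul_zero]
      · rw [h0 i h.ge, zero_mul]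
    rw [hev, hz, zero_sub, mul_neg, neg_lt_zero]
    refine neg_one_pow_mul_prod_sub_pos hi (fun j hj => ?_) (fun j hj hjn => ?_)
    · exact (hanti (Nat.succ_le_of_lt hj)).trans_lt (hs j (hj.trans_le hi))
    · exact (hpc j hjn).trans_le (hanti hj)
  have hroot : ∀ i ≤ n, ∃ y, c i < y ∧ (∀ j, j + 1 = i → y < p * c j) ∧ H.eval y = 0 := by
    intro i hi
    obtain ⟨b, hb, hbj, hbs⟩ : ∃ b, c i < b ∧ (∀ j, j + 1 = i → b = p * c j) ∧
        0 < (-1) ^ i * H.eval b := by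
      rcases i with _ | i
      · have ht : Tendsto (fun y => H.eval y) atTop atTop :=
          H.tendsto_atTop_of_leadingCoeff_nonneg (by rw [hHd]; exact_mod_cast n.succ_pos)
            (by rw [hHm.leadingCoeff]; exact zero_le_one)
        obtain ⟨b, hb, hb'⟩ := ((ht.eventually_gt_atTop 0).and (eventually_gt_atTop (c 0))).exists
        exact ⟨b, hb', by simp, by simpa using hb⟩
      · refine ⟨p * c i, hs i hi, fun j hj => by simp_all, ?_⟩
        have hz : ∏ j ∈ range n, (p * c i - p * c j) = 0 :=
          Finset.prod_eq_zero (Finset.mem_range.2 hi) (sub_self _)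
        rw [hev, hz, sub_zero, mul_left_comm]
        refine mul_pos (mul_pos hp0 (hpos i hi)) (neg_one_pow_mul_prod_sub_pos hi
          (fun j hj => ?_) (fun j hj hjn => ?_))
        · exact (hpc i hi).trans_le (hanti (Nat.lt_succ_iff.1 hj))
        · exact (hanti hj).trans_lt (hs i hi)
    have hcont : ContinuousOn (fun y => (-1) ^ i * H.eval y) (Set.Icc (c i) b) := by fun_prop
    obtain ⟨y, hy, hy0⟩ := intermediate_value_Ioo hb.le hcont ⟨hleft i hi, hbs⟩
    refine ⟨y, hy.1, fun j hj => hbj j hj ▸ hy.2, ?_⟩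
    simpa using hy0
  choose! r hr1 hr2 hr3 using hroot
  have hrs : ∀ i < n, r (i + 1) < p * r i := fun i hi =>
    (hr2 (i + 1) hi i rfl).trans (mul_lt_mul_of_pos_left (hr1 i hi.le) hp0)
  have hrpos : ∀ i ≤ n, 0 < r i := fun i hi => (hnn i).trans_lt (hr1 i hi)
  have hinj : Set.InjOn r (range (n + 1) : Finset ℕ) := by
    have hsa : StrictAntiOn r (Set.Iic n) := by
      refine strictAntiOn_of_succ_lt Set.ordConnected_Iic fun i _ _ hi => ?_
      have hi' : i < n := by simpa [Nat.succ_le_iff] using hi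
      exact (hrs i hi').trans (mul_lt_of_lt_one_left (hrpos i hi'.le) hp1)
    exact hsa.injOn.mono fun i hi => by simpa [Nat.lt_succ_iff] using hi
  have hprod : H = ∏ i ∈ range (n + 1), (X - C (r i)) := by
    have hm3 : (∏ i ∈ range (n + 1), (X - C (r i)) : ℝ[X]).Monic := monic_prod_X_sub_C _ _
    have hd3 : (∏ i ∈ range (n + 1), (X - C (r i)) : ℝ[X]).degree = ((n + 1 : ℕ) : WithBot ℕ) := by
      rw [degree_eq_natDegree hm3.ne_zero, natDegree_finsetProd_X_sub_C_eq_card, card_range]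
    refine Polynomial.eq_of_degree_sub_lt_of_eval_index_eq (range (n + 1)) hinj ?_ fun i hi => ?_
    · rw [card_range, ← hHd]
      exact degree_sub_lt_left (hHd.trans hd3.symm) hHm.ne_zero (by rw [hHm, hm3])
    · rw [hr3 i (Nat.lt_succ_iff.1 (Finset.mem_range.1 hi)), eval_prod,
        Finset.prod_eq_zero hi (by simp)]
  refine ⟨fun i => if i ≤ n then r i else 0, fun i hi => if_neg (by omega), fun i hi => ?_,
    fun y => ?_⟩
  · rcases (Nat.lt_succ_iff.1 hi).lt_or_eq with h | h
    · simp only [if_pos h.le, if_pos (Nat.succ_le_of_lt h), hrs i h]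
    · subst h
      simpa using mul_pos hp0 (hrpos i le_rfl)
  · rw [← hev, hprod, eval_prod]
    refine Finset.prod_congr rfl fun i hi => ?_
    simp [Nat.lt_succ_iff.1 (Finset.mem_range.1 hi)]

/-- The polynomial `∑ j, (n choose j) p ^ (j choose 2) x ^ j` has only real negative roots, and the
negatives of their reciprocals decay geometrically with ratio `p`. -/
theorem exists_prod_eq_sum_choose {p : ℝ} (hp0 : 0 < p) (hp1 : p < 1) (n : ℕ) :
    ∃ c : ℕ → ℝ, (∀ i, n ≤ i → c i = 0) ∧ (∀ i < n, c (i + 1) < p * c i) ∧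
      ∀ x : ℝ, ∏ i ∈ range n, (1 + c i * x) =
        ∑ j ∈ range (n + 1), (n.choose j : ℝ) * p ^ (j.choose 2) * x ^ j := by
  induction n with
  | zero => exact ⟨0, by simp, by simp, by simp⟩
  | succ n ih =>
    obtain ⟨c, h0, hs, hc⟩ := ih
    obtain ⟨c', h0', hs', hc'⟩ := exists_roots_interlacing hp0 hp1 n c h0 hs
    refine ⟨c', h0', hs', fun x => ?_⟩
    have hrec : ∏ i ∈ range (n + 1), (1 + c' i * x) =
        ∏ i ∈ range n, (1 + c i * x) + x * ∏ i ∈ range n, (1 + c i * (p * x)) := by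
      rcases eq_or_ne x 0 with rfl | hx
      · simp
      -- substitute `y = -1 / x`, turning each `1 + c x` into `-x * (y - c)`
      have hscale : ∀ (m : ℕ) (b : ℕ → ℝ), ∏ i ∈ range m, (1 + b i * x) =
          (-x) ^ m * ∏ i ∈ range m, (-1 / x - b i) := by
        intro m b
        conv_rhs => rw [← Finset.card_range m, ← Finset.prod_const]
        rw [Finset.card_range, ← Finset.prod_mul_distrib]
        exact Finset.prod_congr rfl fun i _ => by field_simp; ring
      have h2 : ∏ i ∈ range n, (1 + c i * (p * x)) = ∏ i ∈ range n, (1 + p * c i * x) :=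
        Finset.prod_congr rfl fun i _ => by ring
      rw [h2, hscale, hscale, hscale, ← hc']
      field_simp
      ring
    rw [hrec, hc, hc, Finset.sum_range_succ' _ (n + 1), Finset.sum_range_succ' _ n,
      Finset.mul_sum]
    have hch : ∀ j : ℕ, (j + 1).choose 2 = j + j.choose 2 := fun j => by
      rw [Nat.choose_succ_succ' j 1, Nat.choose_one_right]
    have key : ∀ j ∈ range (n + 1),
        ((n + 1).choose (j + 1) : ℝ) * p ^ ((j + 1).choose 2) * x ^ (j + 1) =
        (n.choose (j + 1) : ℝ) * p ^ ((j + 1).choose 2) * x ^ (j + 1) +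
        x * ((n.choose j : ℝ) * p ^ (j.choose 2) * (p * x) ^ j) := by
      intro j _
      rw [Nat.choose_succ_succ', hch]
      push_cast
      ring
    rw [Finset.sum_congr rfl key, Finset.sum_add_distrib, Finset.sum_range_succ
      (fun j => (n.choose (j + 1) : ℝ) * p ^ ((j + 1).choose 2) * x ^ (j + 1)) n]
    simp
    ring

/-! ### Infinite products and elementary symmetric functions -/

/-- The `k`-th elementary symmetric function of the sequence `c`: the sum over all `k`-element sets
of indices of the product of the corresponding terms. The sum converges when `c` is summable and
nonnegative, or has finitely many nonzero terms. -/
noncomputable def esymmTsum (c : ℕ → ℝ) (k : ℕ) : ℝ :=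
  ∑' s : {s : Finset ℕ // #s = k}, ∏ i ∈ s.1, c i

theorem esymmTsum_one (c : ℕ → ℝ) : esymmTsum c 1 = ∑' i, c i := by
  have hb : Function.Bijective
      (fun i : ℕ => (⟨{i}, card_singleton i⟩ : {s : Finset ℕ // #s = 1})) := by
    refine ⟨fun i j h => by simpa using h, fun ⟨s, hs⟩ => ?_⟩
    obtain ⟨i, rfl⟩ := Finset.card_eq_one.1 hs
    exact ⟨i, rfl⟩
  rw [esymmTsum, ← (Equiv.ofBijective _ hb).tsum_eq]
  simp

theorem esymmTsum_eq_zero {c : ℕ → ℝ} {n k : ℕ} (hc : ∀ i, n ≤ i → c i = 0) (hk : n < k) :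
    esymmTsum c k = 0 := by
  refine (tsum_congr fun s => ?_).trans tsum_zero
  obtain ⟨i, his, hi⟩ : ∃ i ∈ s.1, i ∉ range n :=
    Finset.exists_mem_notMem_of_card_lt_card (by rwa [card_range, s.2])
  exact Finset.prod_eq_zero his (hc i (by simpa using hi))

/-- Vieta's formula for a sequence with finitely many nonzero terms. -/
theorem esymmTsum_eq_coeff {c a : ℕ → ℝ} {n k : ℕ} (hc : ∀ i, n ≤ i → c i = 0) (hk : k ≤ n)
    (h : ∀ x : ℝ, ∏ i ∈ range n, (1 + c i * x) = ∑ j ∈ range (n + 1), a j * x ^ j) :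
    esymmTsum c k = a k := by
  have hpoly : ∏ i ∈ range n, (1 + C (c i) * X) = ∑ j ∈ range (n + 1), C (a j) * X ^ j :=
    Polynomial.funext fun x => by simpa [eval_prod, eval_finsetSum] using h x
  have hcoef := congrArg (fun q => q.coeff k) hpoly
  simp only [Finset.prod_one_add, Finset.prod_mul_distrib, Finset.prod_const, ← map_prod,
    finsetSum_coeff, coeff_C_mul_X_pow] at hcoef
  rw [Finset.sum_ite_eq, if_pos (by simpa [Nat.lt_succ_iff] using hk)] at hcoef
  have hind : esymmTsum c k =
      ∑' s, Set.indicator {s : Finset ℕ | #s = k} (fun s => ∏ i ∈ s, c i) s :=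
    tsum_subtype {s : Finset ℕ | #s = k} fun s => ∏ i ∈ s, c i
  rw [← hcoef, hind, tsum_eq_sum (s := (range n).powerset)]
  · refine Finset.sum_congr rfl fun s _ => ?_
    simp [Set.indicator_apply, eq_comm]
  · intro s hs
    obtain ⟨i, his, hi⟩ := Finset.not_subset.1 (fun h => hs (Finset.mem_powerset.2 h))
    rw [Set.indicator_apply, Finset.prod_eq_zero his (hc i (by simpa using hi)), ite_self]

/-- The finite approximation: a sequence with the elementary symmetric functions of the polynomial
`∑ j, (n choose j) p ^ (j choose 2) (x / n) ^ j`, whose coefficients converge to those of the deformed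
exponential. The bound `p ^ i` does not depend on `n`: it combines the decay with `d 0 ≤ ∑ d i = 1`. -/
theorem exists_esymmTsum_eq_choose {p : ℝ} (hp0 : 0 < p) (hp1 : p < 1) (n : ℕ) :
    ∃ d : ℕ → ℝ, (∀ i, 0 ≤ d i) ∧ (∀ i, d (i + 1) ≤ p * d i) ∧ (∀ i, d i ≤ p ^ i) ∧
      ∀ k ≤ n, esymmTsum d k = (n.choose k : ℝ) / n ^ k * p ^ (k.choose 2) := by
  obtain ⟨c, h0, hs, hc⟩ := exists_prod_eq_sum_choose hp0 hp1 n
  have hnn := nonneg_of_succ_lt_mul hp0 h0 hs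
  have hle := succ_le_mul_of_succ_lt_mul h0 hs
  have hd0 : ∀ i, n ≤ i → c i / n = 0 := fun i hi => by rw [h0 i hi, zero_div]
  have hnn' : ∀ i, 0 ≤ c i / n := fun i => div_nonneg (hnn i) n.cast_nonneg
  have hle' : ∀ i, c (i + 1) / n ≤ p * (c i / n) := fun i => by
    rw [← mul_div_assoc]; exact div_le_div_of_nonneg_right (hle i) n.cast_nonneg
  have hes : ∀ k ≤ n, esymmTsum (fun i => c i / n) k =
      (n.choose k : ℝ) / n ^ k * p ^ (k.choose 2) := fun k hk => by
    refine esymmTsum_eq_coeff (a := fun k => (n.choose k : ℝ) / n ^ k * p ^ (k.choose 2)) hd0 hk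
      fun x => ?_
    have h1 : ∏ i ∈ range n, (1 + c i / n * x) = ∏ i ∈ range n, (1 + c i * (x / n)) :=
      Finset.prod_congr rfl fun i _ => by ring
    rw [h1, hc]
    exact Finset.sum_congr rfl fun j _ => by rw [div_pow]; ring
  have hfirst : c 0 / n ≤ 1 := by
    rcases n.eq_zero_or_pos with rfl | hn
    · simp
    have hsum : ∑' i, c i / n = 1 := by
      rw [← esymmTsum_one, hes 1 hn]
      have : (n : ℝ) ≠ 0 := by positivity
      simp [this]
    rw [← hsum]
    refine Summable.le_tsum (f := fun i => c i / n) ?_ 0 fun i _ => hnn' i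
    exact summable_of_ne_finset_zero (s := range n) fun i hi => hd0 i (by simpa using hi)
  refine ⟨fun i => c i / n, hnn', hle', fun i => ?_, hes⟩
  induction i with
  | zero => simpa using hfirst
  | succ i ih => exact (hle' i).trans (by rw [pow_succ']; gcongr)

/-- The limit of the finite approximations, along a subsequence provided by Tychonoff's theorem.
The uniform bound by `p ^ i` lets the elementary symmetric functions pass to the limit. -/
theorem exists_esymmTsum_eq {p : ℝ} (hp0 : 0 < p) (hp1 : p < 1) :
    ∃ c : ℕ → ℝ, (∀ i, 0 ≤ c i) ∧ (∀ i, c (i + 1) ≤ p * c i) ∧ (∀ i, c i ≤ p ^ i) ∧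
      ∀ k, esymmTsum c k = p ^ (k.choose 2) / k.factorial := by
  choose d hd0 hds hdp hde using exists_esymmTsum_eq_choose hp0 hp1
  have hK : IsCompact (Set.univ.pi fun i : ℕ => Set.Icc (0 : ℝ) (p ^ i)) :=
    isCompact_univ_pi fun i => isCompact_Icc
  obtain ⟨c, hcK, φ, hφ, hlim⟩ := hK.tendsto_subseq (x := d)
    fun n i _ => ⟨hd0 n i, hdp n i⟩
  rw [tendsto_pi_nhds] at hlim
  refine ⟨c, fun i => (hcK i trivial).1, fun i => ?_, fun i => (hcK i trivial).2, fun k => ?_⟩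
  · exact le_of_tendsto_of_tendsto' (hlim (i + 1)) ((hlim i).const_mul p) fun n => hds _ i
  have hbound : Summable fun s : {s : Finset ℕ // #s = k} => ∏ i ∈ s.1, p ^ i :=
    (summable_finsetProd_of_summable_nonneg (fun i => by positivity)
      (summable_geometric_of_lt_one hp0.le hp1)).subtype {s : Finset ℕ | #s = k}
  have h1 : Tendsto (fun n => esymmTsum (d (φ n)) k) atTop (𝓝 (esymmTsum c k)) := by
    refine tendsto_tsum_of_dominated_convergence hbound
      (fun s => tendsto_finsetProd _ fun i _ => hlim i) (Eventually.of_forall fun n s => ?_)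
    rw [Real.norm_of_nonneg (Finset.prod_nonneg fun i _ => hd0 _ i)]
    exact Finset.prod_le_prod (fun i _ => hd0 _ i) fun i _ => hdp _ i
  have h2 : Tendsto (fun n : ℕ => (n.choose k : ℝ) / n ^ k * p ^ (k.choose 2)) atTop
      (𝓝 (1 / k.factorial * p ^ (k.choose 2))) := by
    refine Tendsto.mul_const _ ?_
    refine ((isEquivalent_choose k).div (v := fun n : ℕ => (n : ℝ) ^ k)
      .refl).symm.tendsto_nhds (c := (1 / k.factorial : ℝ)) ?_
    refine tendsto_const_nhds.congr' ?_
    filter_upwards [eventually_gt_atTop 0] with n hn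
    have : (n : ℝ) ≠ 0 := by positivity
    simp only [Pi.div_apply]
    field_simp
  have h3 := (h2.comp hφ.tendsto_atTop).congr' (f₂ := fun n => esymmTsum (d (φ n)) k) (by
    filter_upwards [hφ.tendsto_atTop.eventually_ge_atTop k] with n hn
    exact (hde _ k hn).symm)
  rw [tendsto_nhds_unique h1 h3, one_div, div_eq_inv_mul]

/-- The infinite product with elementary symmetric functions `esymmTsum c k` is their generating
function. -/
theorem tprod_one_add_mul_eq_tsum_esymmTsum {c : ℕ → ℝ} (hc : Summable c) (h0 : ∀ i, 0 ≤ c i)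
    (z : ℂ) : ∏' i, (1 + (c i : ℂ) * z) = ∑' k : ℕ, (esymmTsum c k : ℂ) * z ^ k := by
  have hn : Summable fun i => ‖(c i : ℂ) * z‖ := by
    simpa [abs_of_nonneg (h0 _)] using hc.mul_right ‖z‖
  have hs := summable_finsetProd_of_summable_norm hn
  rw [tprod_one_add hs, ← (Equiv.sigmaFiberEquiv (Finset.card : Finset ℕ → ℕ)).tsum_eq]
  refine (Summable.tsum_sigma ((Equiv.sigmaFiberEquiv _).summable_iff.2 hs)).trans ?_
  refine tsum_congr fun k => ?_
  rw [esymmTsum, Complex.ofReal_tsum, ← tsum_mul_right]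
  refine tsum_congr fun s => ?_
  simp [Equiv.sigmaFiberEquiv, Finset.prod_mul_distrib, s.2]

theorem differentiable_tprod_one_add_mul {c : ℕ → ℂ} (hc : Summable fun i => ‖c i‖) :
    Differentiable ℂ fun z : ℂ => ∏' i, (1 + c i * z) := by
  have hn (r : ℝ) : Summable fun i => ‖‖c i‖ * r‖ := by
    simpa using hc.mul_right |r|
  have heq : (fun z : ℂ => ∏' i, (1 + c i * z)) = fun z => ∑' s : Finset ℕ, ∏ i ∈ s, c i * z :=
    funext fun z => tprod_one_add (summable_finsetProd_of_summable_norm (by simpa using hn ‖z‖))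
  rw [heq]
  intro z
  have h : DifferentiableOn ℂ (fun z => ∑' s : Finset ℕ, ∏ i ∈ s, c i * z)
      (Metric.ball 0 (‖z‖ + 1)) := by
    refine Complex.differentiableOn_tsum_of_summable_norm
      (summable_finsetProd_of_summable_norm (hn (‖z‖ + 1))) (fun s => ?_) Metric.isOpen_ball
      (fun s w hw => ?_)
    · fun_prop
    · rw [norm_prod]
      refine Finset.prod_le_prod (fun i _ => norm_nonneg _) fun i _ => ?_
      rw [norm_mul]
      exact mul_le_mul_of_nonneg_left (mem_ball_zero_iff.mp hw).le (norm_nonneg _)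
  exact h.differentiableAt (Metric.isOpen_ball.mem_nhds (by simp))

/-- The zeros of the product `∏ (1 + c i z)` with distinct positive `c i` are simple. -/
theorem listsZeros_tprod_one_add_mul {c : ℕ → ℝ} (hc : Summable c) (hpos : ∀ i, 0 < c i)
    (hinj : Function.Injective c) :
    ListsZeros (fun z => ∏' i, (1 + (c i : ℂ) * z)) fun i => ((-1 / c i : ℝ) : ℂ) := by
  have hcn : Summable fun i => ‖(c i : ℂ)‖ := by
    simpa [abs_of_pos (hpos _)] using hc
  have hne : ∀ i, (c i : ℂ) ≠ 0 := fun i => by exact_mod_cast (hpos i).ne'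
  have hz : ∀ i (z : ℂ), ((-1 / c i : ℝ) : ℂ) = z ↔ 1 + (c i : ℂ) * z = 0 := by
    intro i z
    have := hne i
    push_cast
    rw [div_eq_iff this, mul_comm z, ← sub_eq_zero, ← neg_eq_zero]
    ring_nf
  intro z
  have han : ∀ b : ℕ → ℂ, (Summable fun i => ‖b i‖) →
      AnalyticAt ℂ (fun z => ∏' i, (1 + b i * z)) z := fun b hb =>
    (differentiable_tprod_one_add_mul hb).analyticAt z
  have hzn : ∀ b : ℕ → ℂ, (Summable fun i => ‖b i‖) → Summable fun i => ‖b i * z‖ := fun b hb => by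
    simpa using hb.mul_right ‖z‖
  by_cases hex : ∃ i, 1 + (c i : ℂ) * z = 0
  · obtain ⟨i, hi⟩ := hex
    have hset : {j : ℕ | ((-1 / c j : ℝ) : ℂ) = z} = {i} := by
      ext j
      simp only [Set.mem_ofPred_eq, Set.mem_singleton_iff]
      refine ⟨fun hj => ?_, fun hj => hj ▸ (hz i z).2 hi⟩
      have h1 := (hj.trans ((hz i z).2 hi).symm)
      have h2 : -1 / c j = -1 / c i := by exact_mod_cast h1
      apply hinj
      simpa [neg_div] using h2
    -- split off the only vanishing factor
    set b : ℕ → ℂ := fun j => if j = i then 0 else (c j : ℂ) with hb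
    have hbn : Summable fun j => ‖b j‖ := by
      refine hcn.of_nonneg_of_le (fun j => norm_nonneg _) fun j => ?_
      by_cases h : j = i <;> simp [hb, h]
    have hfac : (fun z : ℂ => ∏' j, (1 + (c j : ℂ) * z)) =
        (fun z => 1 + (c i : ℂ) * z) * fun z => ∏' j, (1 + b j * z) := by
      ext w
      have hupd : Function.update (fun j => 1 + (c j : ℂ) * w) i 1 = fun j => 1 + b j * w := by
        ext j
        by_cases h : j = i
        · subst h; simp [hb]
        · simp [hb, h]
      have hm : Multipliable fun j => 1 + b j * w :=
        multipliable_one_add_of_summable (by simpa using hbn.mul_right ‖w‖)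
      rw [Multipliable.tprod_eq_mul_tprod_ite' (f := fun j => 1 + (c j : ℂ) * w) i
        (by rwa [hupd]), Pi.mul_apply]
      congr 1
      refine tprod_congr fun j => ?_
      by_cases h : j = i <;> simp [hb, h]
    have h1 : analyticOrderAt (fun z : ℂ => 1 + (c i : ℂ) * z) z = 1 := by
      refine AnalyticAt.analyticOrderAt_eq_one_of_zero_deriv_ne_zero (by fun_prop) hi ?_
      simpa using hne i
    have h2 : analyticOrderAt (fun z : ℂ => ∏' j, (1 + b j * z)) z = 0 := by
      refine (han b hbn).analyticOrderAt_eq_zero.2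
        (tprod_one_add_ne_zero_of_summable (fun j => ?_) (hzn b hbn))
      by_cases h : j = i
      · simp [hb, h]
      · intro h0
        have : j ∈ {j : ℕ | ((-1 / c j : ℝ) : ℂ) = z} := (hz j z).2 (by simpa [hb, h] using h0)
        rw [hset] at this
        exact h this
    rw [hset, Set.encard_singleton, hfac, analyticOrderAt_mul (by fun_prop) (han b hbn), h1, h2,
      add_zero]
  · push Not at hex
    rw [(han _ hcn).analyticOrderAt_eq_zero.2
      (tprod_one_add_ne_zero_of_summable hex (hzn _ hcn)), Set.encard_eq_zero]
    ext i
    simpa only [Set.mem_ofPred_eq, Set.mem_empty_iff_false, iff_false, hz] using hex i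

/-- The factorization of the deformed exponential: `f_p (z) = ∏ (1 + c i z)` with positive
`c i` that decay geometrically and whose elementary symmetric functions are the Taylor coefficients
of `f_p`. -/
theorem exists_deformedExp_eq_tprod {p : ℝ} (hp0 : 0 < p) (hp1 : p < 1) :
    ∃ c : ℕ → ℝ, (∀ i, 0 < c i) ∧ (∀ i, c (i + 1) ≤ p * c i) ∧ Summable c ∧
      (∀ k, esymmTsum c k = p ^ (k.choose 2) / k.factorial) ∧
      deformedExp p = fun z => ∏' i, (1 + (c i : ℂ) * z) := by
  obtain ⟨c, h0, hs, hle, he⟩ := exists_esymmTsum_eq hp0 hp1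
  have hsum : Summable c :=
    (summable_geometric_of_lt_one hp0.le hp1).of_nonneg_of_le h0 hle
  have hanti : Antitone c := antitone_nat_of_succ_le fun i =>
    (hs i).trans (mul_le_of_le_one_left (h0 i) hp1.le)
  refine ⟨c, fun i => (h0 i).lt_of_ne' fun hi => ?_, hs, hsum, he, funext fun z => ?_⟩
  · -- otherwise `f_p` would be a polynomial
    have h := esymmTsum_eq_zero (c := c) (n := i) (k := i + 1)
      (fun j hj => le_antisymm ((hanti hj).trans hi.le) (h0 j)) i.lt_succ_self
    rw [he] at h
    have : 0 < p ^ ((i + 1).choose 2) / ((i + 1).factorial : ℝ) := by positivity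
    exact this.ne' h
  · rw [tprod_one_add_mul_eq_tsum_esymmTsum hsum h0, deformedExp]
    exact tsum_congr fun k => by rw [he]; push_cast; ring

/-! ### The graph -/

/-- The injections of `Fin k` onto a given `k`-element set number `k!`. -/
theorem card_embedding_map_univ_eq {α : Type*} {k : ℕ} (s : {s : Finset α // #s = k}) :
    ENat.card {σ : Fin k ↪ α // (univ.map σ : Finset α) = s.1} = k.factorial := by
  classical
  have hb : Function.Bijective (fun e : Fin k ≃ s.1 =>
      (⟨e.toEmbedding.trans (Function.Embedding.subtype _), by
        ext x
        simp only [Finset.mem_map, Finset.mem_univ, true_and]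
        exact ⟨fun ⟨i, hi⟩ => hi ▸ (e i).2, fun hx => ⟨e.symm ⟨x, hx⟩, by simp⟩⟩⟩ :
        {σ : Fin k ↪ α // (univ.map σ : Finset α) = s.1})) := by
    constructor
    · intro e e' h
      ext i
      simpa using congrArg (fun σ => σ.1 i) h
    · rintro ⟨σ, hσ⟩
      have hm : ∀ i, σ i ∈ s.1 := fun i => hσ ▸ Finset.mem_map_of_mem σ (Finset.mem_univ i)
      have hbij : Function.Bijective (fun i => (⟨σ i, hm i⟩ : s.1)) := by
        rw [Fintype.bijective_iff_injective_and_card]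
        exact ⟨fun i j h => σ.injective (congrArg Subtype.val h), by simp [s.2]⟩
      exact ⟨Equiv.ofBijective _ hbij, rfl⟩
  have e : Fin k ≃ s.1 := Fintype.equivOfCardEq (by simp [s.2])
  rw [← ENat.card_congr (Equiv.ofBijective _ hb), ENat.card_eq_coe_fintype_card,
    Fintype.card_equiv e, Fintype.card_fin]

/-- Each `k`-element set of indices is the image of `k!` injections from `Fin k`. -/
theorem tsum_embedding_prod_eq {c : ℕ → ℝ} (hc : Summable c) (h0 : ∀ i, 0 ≤ c i) (k : ℕ) :
    ∑' σ : Fin k ↪ ℕ, ∏ i, ENNReal.ofReal (c (σ i)) =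
      ENNReal.ofReal (k.factorial * esymmTsum c k) := by
  set g : (Fin k ↪ ℕ) → {s : Finset ℕ // #s = k} := fun σ => ⟨univ.map σ, by simp⟩ with hg
  have hfib : ∀ s : {s : Finset ℕ // #s = k},
      ∑' σ : g ⁻¹' {s}, ∏ i, ENNReal.ofReal (c (σ.1 i)) =
        k.factorial * ENNReal.ofReal (∏ i ∈ s.1, c i) := by
    intro s
    have hcard : ENat.card (g ⁻¹' {s}) = k.factorial := by
      rw [← card_embedding_map_univ_eq s]
      exact ENat.card_congr (Equiv.subtypeEquivRight fun σ => by simp [hg, Subtype.ext_iff])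
    have hconst : ∀ σ : g ⁻¹' {s}, ∏ i, ENNReal.ofReal (c (σ.1 i)) =
        ENNReal.ofReal (∏ i ∈ s.1, c i) := by
      rintro ⟨σ, hσ⟩
      have hσ' : univ.map σ = s.1 := congrArg Subtype.val hσ
      rw [← hσ', Finset.prod_map, ENNReal.ofReal_prod_of_nonneg fun i _ => h0 _]
    rw [tsum_congr hconst, ENNReal.tsum_const, hcard]
    simp
  have hs : Summable fun s : {s : Finset ℕ // #s = k} => ∏ i ∈ s.1, c i :=
    (summable_finsetProd_of_summable_nonneg h0 hc).subtype {s : Finset ℕ | #s = k}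
  rw [← ENNReal.tsum_fiberwise _ g, tsum_congr hfib, ENNReal.tsum_mul_left,
    ← ENNReal.ofReal_tsum_of_nonneg (fun s => Finset.prod_nonneg fun i _ => h0 i) hs,
    ENNReal.ofReal_mul (by positivity), ENNReal.ofReal_natCast, esymmTsum]

/-- `k` independent points form a clique exactly when they lie in distinct parts, so the clique
probability is a sum over injective assignments of parts to the points. -/
theorem volume_clique_eq_tsum {X : Type*} [MeasureSpace X] [SigmaFinite (volume : Measure X)]
    {W : SimpleGraph X} {V : ℕ → Set X} (hW : IsCompleteInfinitePartite W V)
    (hV : ∀ i, MeasurableSet (V i)) (k : ℕ) :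
    volume {v : Fin k → X | ∀ i j, i < j → W.Adj (v i) (v j)} =
      ∑' σ : Fin k ↪ ℕ, ∏ i, volume (V (σ i)) := by
  have huniq : ∀ {x i j}, x ∈ V i → x ∈ V j → i = j := fun {x i j} hi hj => by
    by_contra h
    exact Set.disjoint_left.1 (hW.disjoint h) hi hj
  have hset : {v : Fin k → X | ∀ i j, i < j → W.Adj (v i) (v j)} =
      ⋃ σ : Fin k ↪ ℕ, Set.univ.pi fun i => V (σ i) := by
    ext v
    simp only [Set.mem_ofPred_eq, Set.mem_iUnion, Set.mem_univ_pi]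
    constructor
    · intro h
      have hex : ∀ i, ∃ m, v i ∈ V m := fun i => by
        have := hW.cover.ge (Set.mem_univ (v i))
        simpa using this
      choose m hm using hex
      refine ⟨⟨m, fun i j hij => ?_⟩, hm⟩
      have key : ∀ i j, i < j → m i ≠ m j := fun i j hlt he => by
        obtain ⟨a, b, hab, ha, hb⟩ := (hW.adj_iff _ _).1 (h i j hlt)
        exact hab ((huniq ha (hm i)).trans (he.trans (huniq (hm j) hb)))
      by_contra hne
      rcases lt_or_gt_of_ne hne with hlt | hlt
      · exact key i j hlt hij
      · exact key j i hlt hij.symm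
    · rintro ⟨σ, hσ⟩ i j hij
      exact (hW.adj_iff _ _).2 ⟨σ i, σ j, fun h => hij.ne (σ.injective h), hσ i, hσ j⟩
  have hdisj : Pairwise fun σ τ : Fin k ↪ ℕ =>
      Disjoint (Set.univ.pi fun i => V (σ i)) (Set.univ.pi fun i => V (τ i)) := by
    intro σ τ hne
    refine Set.disjoint_left.2 fun v hσ hτ => hne ?_
    ext i
    exact huniq (hσ i trivial) (hτ i trivial)
  have : Countable (Fin k ↪ ℕ) := DFunLike.coe_injective.countable
  rw [hset, measure_iUnion hdisj fun σ => MeasurableSet.univ_pi fun i => hV _]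
  exact tsum_congr fun σ => volume_pi_pi _

/-- Positive numbers summing to `1` are the lengths of the parts of a partition of `[0, 1]` into
intervals. The first interval is the rightmost one, `[1 - c 0, 1]`, and the others follow each other
from `0` on; their endpoints accumulate at `1 - c 0`, so no point is missed. -/
theorem exists_interval_partition {c : ℕ → ℝ} (hpos : ∀ i, 0 < c i) (hc : HasSum c 1) :
    ∃ V : ℕ → Set unitInterval, (Pairwise fun i j => Disjoint (V i) (V j)) ∧
      ⋃ i, V i = Set.univ ∧ (∀ i, (V i).OrdConnected) ∧
      (∀ i, volume (V i) = ENNReal.ofReal (c i)) ∧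
      ∀ x : unitInterval, 1 - c 0 ≤ (x : ℝ) → x ∈ V 0 := by
  set u : ℕ → ℝ := fun n => ∑ j ∈ range n, c (j + 1) with hu
  have hus : ∀ n, u (n + 1) = u n + c (n + 1) := fun n => Finset.sum_range_succ _ _
  have hmono : Monotone u := monotone_nat_of_le_succ fun n => by
    rw [hus]; linarith [hpos (n + 1)]
  have hlim : Tendsto u atTop (𝓝 (1 - c 0)) := by
    have := (hasSum_nat_add_iff' 1).2 hc
    simpa using this.tendsto_sum_nat
  have hle : ∀ n, u n ≤ 1 - c 0 := hmono.ge_of_tendsto hlim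
  have hu0 : u 0 = 0 := by simp [hu]
  have hunn : ∀ n, 0 ≤ u n := fun n => hu0 ▸ hmono n.zero_le
  have hc1 : 0 ≤ 1 - c 0 := (hunn 0).trans (hle 0)
  set V : ℕ → Set unitInterval := fun n => Nat.casesOn n {x | 1 - c 0 ≤ (x : ℝ)}
    (fun n => {x | u n ≤ (x : ℝ) ∧ (x : ℝ) < u (n + 1)}) with hV
  have hVs : ∀ n (x : unitInterval), x ∈ V (n + 1) ↔ u n ≤ (x : ℝ) ∧ (x : ℝ) < u (n + 1) :=
    fun _ _ => Iff.rfl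
  refine ⟨V, (pairwise_disjoint_on V).2 fun m n hmn => ?_, ?_, fun i => ?_, fun i => ?_, fun x hx => hx⟩
  · obtain ⟨n, rfl⟩ := Nat.exists_eq_add_one_of_ne_zero (Nat.ne_zero_of_lt hmn)
    refine Set.disjoint_left.2 fun x hx hx' => ?_
    rw [hVs] at hx'
    rcases m with _ | m
    · exact absurd (hx'.2.trans_le (hle _)) (not_lt.2 hx)
    · exact absurd (hx.2.trans_le (hmono (Nat.lt_succ_iff.1 hmn))) (not_lt.2 hx'.1)
  · refine Set.eq_univ_of_forall fun x => Set.mem_iUnion.2 ?_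
    rcases le_or_gt (1 - c 0) (x : ℝ) with h | h
    · exact ⟨0, h⟩
    · have hex : ∃ n, (x : ℝ) < u n := (hlim.eventually_const_lt h).exists
      obtain ⟨n, hn⟩ : ∃ n, Nat.find hex = n + 1 :=
        Nat.exists_eq_add_one_of_ne_zero fun h0 => by
          have := Nat.find_spec hex
          rw [h0, hu0] at this
          exact absurd x.2.1 (not_le.2 this)
      exact ⟨n + 1, not_lt.1 (Nat.find_min hex (by omega)), hn ▸ Nat.find_spec hex⟩
  · rcases i with _ | n
    · exact ⟨fun x hx y hy z hz => le_trans (α := ℝ) hx hz.1⟩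
    · exact ⟨fun x hx y hy z hz => ⟨le_trans (α := ℝ) hx.1 hz.1, lt_of_le_of_lt (α := ℝ) hz.2 hy.2⟩⟩
  · rcases i with _ | n
    · have h := unitInterval.volume_Ici ⟨1 - c 0, hc1, by linarith [hpos 0]⟩
      exact h.trans (congrArg ENNReal.ofReal (sub_sub_cancel 1 (c 0)))
    · have hb : ∀ n, u n ∈ unitInterval := fun n => ⟨hunn n, by linarith [hle n, hpos 0]⟩
      have h := unitInterval.volume_Ico ⟨u n, hb n⟩ ⟨u (n + 1), hb (n + 1)⟩
      exact h.trans (congrArg ENNReal.ofReal (sub_eq_of_eq_add' (hus n)))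

theorem mainTheorem3 (p : ℝ) (hp0 : 0 < p) (hp1 : p < 1) :
    ∃ (W : SimpleGraph unitInterval) (a : ℕ → ℝ) (V : ℕ → Set unitInterval),
      -- `W` is a graphon: its set of edges is measurable
      MeasurableSet {q : unitInterval × unitInterval | W.Adj q.1 q.2} ∧
      -- the `a i` are the zeros of the deformed exponential; they are all real and negative,
      -- and are listed in descending order, so that so are the `-1 / a i`
      ListsZeros (deformedExp p) (fun i => (a i : ℂ)) ∧
      (∀ i, a i < 0) ∧
      Antitone a ∧
      -- `W` is complete infinite-partite on intervals of lengths `-1 / a i`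
      IsCompleteInfinitePartite W V ∧
      (∀ i, (V i).OrdConnected) ∧
      (∀ i, volume (V i) = ENNReal.ofReal (-1 / a i)) ∧
      -- `k` independent uniform points form a clique with probability `p ^ (k choose 2)`
      (∀ k : ℕ, 2 ≤ k →
        volume {v : Fin k → unitInterval | ∀ i j, i < j → W.Adj (v i) (v j)} =
          ENNReal.ofReal (p ^ (k.choose 2))) ∧
      -- the longest part has length at least `1 - p`, and there is an independent interval of
      -- length exactly `1 - p`
      1 - p ≤ -1 / a 0 ∧
      (∃ I : Set unitInterval, I.OrdConnected ∧ volume I = ENNReal.ofReal (1 - p) ∧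
        W.IsIndepSet I) := by
  obtain ⟨c, hpos, hdecay, hsum, he, hprod⟩ := exists_deformedExp_eq_tprod hp0 hp1
  have h0 : ∀ i, 0 ≤ c i := fun i => (hpos i).le
  have hanti : StrictAnti c := strictAnti_nat_of_succ_lt fun i =>
    (hdecay i).trans_lt (mul_lt_of_lt_one_left (hpos i) hp1)
  have hone : HasSum c 1 := by
    have h := hsum.hasSum
    rwa [← esymmTsum_one, he, Nat.choose_eq_zero_of_lt one_lt_two, pow_zero, Nat.factorial_one,
      Nat.cast_one, div_one] at h
  -- `1 = ∑ c i ≤ c 0 * ∑ p ^ i = c 0 / (1 - p)`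
  have hlarge : 1 - p ≤ c 0 := by
    have hle : ∀ i, c i ≤ c 0 * p ^ i := fun i => by
      induction i with
      | zero => simp
      | succ i ih =>
        calc c (i + 1) ≤ p * c i := hdecay i
          _ ≤ p * (c 0 * p ^ i) := by gcongr
          _ = c 0 * p ^ (i + 1) := by ring
    have h := hasSum_le hle hone ((hasSum_geometric_of_lt_one hp0.le hp1).mul_left (c 0))
    rwa [← div_eq_mul_inv, le_div_iff₀ (sub_pos.2 hp1), one_mul] at h
  obtain ⟨V, hdisj, hcover, hord, hvol, hV0⟩ := exists_interval_partition hpos hone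
  have huniq : ∀ {x i j}, x ∈ V i → x ∈ V j → i = j := fun {x i j} hi hj => by
    by_contra h
    exact Set.disjoint_left.1 (hdisj h) hi hj
  let W : SimpleGraph unitInterval :=
    { Adj := fun x y => ∃ i j, i ≠ j ∧ x ∈ V i ∧ y ∈ V j
      symm := ⟨fun x y ⟨i, j, hij, hx, hy⟩ => ⟨j, i, hij.symm, hy, hx⟩⟩
      loopless := ⟨fun x ⟨i, j, hij, hx, hy⟩ => hij (huniq hx hy)⟩ }
  have hmeas : ∀ i, MeasurableSet (V i) := fun i => (hord i).measurableSet
  have hW : IsCompleteInfinitePartite W V :=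
    { disjoint := hdisj
      cover := hcover
      nonempty := fun i => nonempty_of_measure_ne_zero (μ := volume) <| by
        rw [hvol]; exact (ENNReal.ofReal_pos.2 (hpos i)).ne'
      adj_iff := fun x y => Iff.rfl }
  have hinv : ∀ i, -1 / (-1 / c i) = c i := fun i => by
    have := (hpos i).ne'
    field_simp
  refine ⟨W, fun i => -1 / c i, V, ?_, ?_, fun i => div_neg_of_neg_of_pos (by norm_num) (hpos i),
    fun i j hij => ?_, hW, hord, fun i => by rw [hvol, hinv], fun k _ => ?_, by rwa [hinv], ?_⟩
  · have hset : {q : unitInterval × unitInterval | W.Adj q.1 q.2} =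
        ⋃ (i) (j) (_ : i ≠ j), V i ×ˢ V j := by
      ext q
      simp only [W, Set.mem_ofPred_eq, Set.mem_iUnion, Set.mem_prod, exists_prop]
    rw [hset]
    exact .iUnion fun i => .iUnion fun j => .iUnion fun _ => (hmeas i).prod (hmeas j)
  · rw [hprod]
    exact listsZeros_tprod_one_add_mul hsum hpos hanti.injective
  · have h := one_div_le_one_div_of_le (hpos j) (hanti.antitone hij)
    simp only [neg_div]
    linarith
  · have hk : (k.factorial : ℝ) ≠ 0 := by positivity
    rw [volume_clique_eq_tsum hW hmeas, tsum_congr fun σ => Finset.prod_congr rfl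
      fun i _ => hvol (σ i), tsum_embedding_prod_eq hsum h0, he, mul_div_cancel₀ _ hk]
  · -- the interval `[p, 1]`, contained in the rightmost part `[1 - c 0, 1]`
    refine ⟨Set.Ici ⟨p, hp0.le, hp1.le⟩, Set.ordConnected_Ici, unitInterval.volume_Ici _, ?_⟩
    have hsub : ∀ x ∈ Set.Ici (⟨p, hp0.le, hp1.le⟩ : unitInterval), x ∈ V 0 := fun x hx => by
      have : p ≤ (x : ℝ) := hx
      exact hV0 x (by linarith)
    rintro x hx y hy - ⟨i, j, hij, hi, hj⟩
    exact hij ((huniq hi (hsub x hx)).trans (huniq (hsub y hy) hj))
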